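/- An $r$-graph on a finite vertex set $V$ is a family $\mathcal H$ of $r$-element subsets of $V$. For integers $q\ge p\ge r\ge 2$, it has the $(q,p)$-property if every $q$-element set $A\subseteq V$ contains a $p$-element set $B$ all of whose $r$-element subsets belong to $\mathcal H$. Let $T_r(n,q,p)$ be the minimum number of edges of an $n$-vertex $r$-graph with the $(q,p)$-property, let $$t_r(q,p)=\lim_{n\to\infty}\frac{T_r(n,q,p)}{\binom nr},$$ and for real $\gamma\ge 1$ let $$\tilde t_r(\gamma)=\lim_{q\to\infty}t_r(q,\lceil q/\gamma\rceil).$$ Assume that Turán's conjecture holds, that is, $t_3(k+1,3)=\frac{4}{k^2}$ for every integer $k\ge 2$. Then for every integer $k\ge 2$ and every real $\gamma$ with $1\le\gamma<\frac{k+1}{2}$, the limit defining $\tilde t_3(\gamma)$ exists and $$\tilde t_3(\gamma)\ge\frac{4}{k^2}.$$ In particular, for every integer $t\ge 1$ and every real $\gamma$ with $t\le\gamma<t+\frac12$, $$\tilde t_3(\gamma)=\frac{1}{t^2}.$$ -/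

import Mathlib

namespace LocalTuran

/-- A family `H` of subsets of `V` is an `r`-graph on the vertex set `V` if all its members
(the edges) have size `r`. -/
def IsRGraph {V : Type*} (r : ℕ) (H : Finset (Finset V)) : Prop :=
  ∀ e ∈ H, e.card = r

/-- The `(q, p)`-property of an `r`-graph `H` with vertex set `V`: every `q`-set `A` of vertices
contains a `p`-set `B` all of whose `r`-subsets are edges. -/
def HasProperty {V : Type*} (r q p : ℕ) (H : Finset (Finset V)) : Prop :=
  ∀ A : Finset V, A.card = q →
    ∃ B : Finset V, B ⊆ A ∧ B.card = p ∧ Finset.powersetCard r B ⊆ H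

/-- `T_r(n, q, p)`: the minimum number of edges of an `n`-vertex `r`-graph with the
`(q, p)`-property. (For `r ≤ p ≤ q` the complete `r`-graph shows that the set is nonempty.) -/
noncomputable def minEdges (r n q p : ℕ) : ℕ :=
  sInf {m : ℕ | ∃ H : Finset (Finset (Fin n)), IsRGraph r H ∧ HasProperty r q p H ∧ H.card = m}

/-- `t_r(q, p) = lim_{n → ∞} T_r(n, q, p) / binom(n, r)`. -/
noncomputable def density (r q p : ℕ) : ℝ :=
  Filter.limUnder Filter.atTop (fun n : ℕ => (minEdges r n q p : ℝ) / (n.choose r : ℝ))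

/-- `t̃_r(γ) = lim_{q → ∞} t_r(q, ⌈q / γ⌉)`. -/
noncomputable def asympDensity (r : ℕ) (γ : ℝ) : ℝ :=
  Filter.limUnder Filter.atTop (fun q : ℕ => density r q ⌈(q : ℝ) / γ⌉₊)

/-- Turán's conjecture: `t_3(k + 1, 3) = 4 / k²` for every integer `k ≥ 2`. -/
def TuranConjecture : Prop :=
  ∀ k : ℕ, 2 ≤ k → density 3 (k + 1) 3 = 4 / (k : ℝ) ^ 2

end LocalTuran

namespace LocalTuran

open Finset Filter Topology

/-! The core is the blow-up inequality `density_le_density`: t_r(q,p) ≤ t_r(Q,P) when Q ≤ qm and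
(p-1)m < P. Call a q-set bad if it contains no p-clique. If a graph with the (Q,P)-property had a
positive proportion of bad q-sets, a large vertex set would carry disjoint parts X_1, ..., X_q of
size m with every transversal bad (`exists_box_subset`). A P-clique inside their union meets at
least p parts, so some transversal contains a p-clique, a contradiction. Hence bad sets are rare, a
typical M-set has none and spans at least T_r(M,q,p) edges, and averaging gives the inequality.

Whenever (p-1)γ < q, it yields t_r(q,p) ≤ t_r(Q,⌈Q/γ⌉) for all large Q. With p = ⌈q/γ⌉ this makes
the limit exist, as a supremum; with (q,p) = (k+1,3) the condition is 2γ < k+1 and Turán's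
conjecture gives 4/k². For t ≤ γ, a disjoint union of t equal cliques supplies the upper bound 1/t².
-/

/-- A vertex set `S` of any type, all of whose `q`-subsets contain a `p`-clique of `H`, spans at
least `T_r(|S|, q, p)` edges. -/
lemma minEdges_le_card_filter {V : Type*} [DecidableEq V] {r q p : ℕ} {H : Finset (Finset V)}
    (hH : IsRGraph r H) (S : Finset V)
    (hS : ∀ A ⊆ S, A.card = q → ∃ B ⊆ A, B.card = p ∧ powersetCard r B ⊆ H) :
    minEdges r S.card q p ≤ (H.filter (· ⊆ S)).card := by
  classical
  let f : Fin S.card ↪ V := S.equivFin.symm.toEmbedding.trans (Function.Embedding.subtype _)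
  have hf : ∀ x, f x ∈ S := fun x => (S.equivFin.symm x).2
  have hfS : univ.map f = S := by
    apply Finset.eq_of_subset_of_card_le
    · intro x hx
      obtain ⟨y, -, rfl⟩ := mem_map.1 hx
      exact hf y
    · simp
  have hsub : ∀ e : Finset (Fin S.card), e.map f ⊆ S := fun e => by
    intro x hx
    obtain ⟨y, -, rfl⟩ := mem_map.1 hx
    exact hf y
  let H' : Finset (Finset (Fin S.card)) := univ.filter (fun e => e.map f ∈ H)
  have hcard : H'.card ≤ (H.filter (· ⊆ S)).card := by
    apply Finset.card_le_card_of_injOn (fun e => e.map f)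
    · intro e he
      have he' : e.map f ∈ H := by simpa [H'] using he
      simpa [he'] using hsub e
    · exact (Finset.map_injective f).injOn
  refine le_trans (Nat.sInf_le ⟨H', ?_, ?_, rfl⟩) hcard
  · intro e he
    have he' : e.map f ∈ H := by simpa [H'] using he
    simpa using hH _ he'
  · intro A hA
    obtain ⟨B, hBA, hB, hBH⟩ := hS (A.map f) (hsub A) (by simpa using hA)
    obtain ⟨B', hB'A, rfl⟩ := Finset.subset_map_iff.1 hBA
    refine ⟨B', hB'A, by simpa using hB, ?_⟩
    intro e he
    have he' := mem_powersetCard.1 he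
    simp only [H', mem_filter, mem_univ, true_and]
    exact hBH (mem_powersetCard.2 ⟨map_subset_map.2 he'.1, by simpa using he'.2⟩)

lemma minEdges_le_card {V : Type*} [Fintype V] {r q p : ℕ} {H : Finset (Finset V)}
    (hH : IsRGraph r H) (hP : HasProperty r q p H) :
    minEdges r (Fintype.card V) q p ≤ H.card := by
  classical
  exact (minEdges_le_card_filter hH univ fun A _ hA => hP A hA).trans (card_filter_le _ _)

lemma hasProperty_complete {V : Type*} [Fintype V] {r q p : ℕ} (hpq : p ≤ q) :
    HasProperty r q p (powersetCard r (univ : Finset V)) := fun A hA => by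
  obtain ⟨B, hBA, hB⟩ := Finset.exists_subset_card_eq (hA ▸ hpq)
  exact ⟨B, hBA, hB, powersetCard_mono (subset_univ _)⟩

lemma exists_card_eq_minEdges (r n : ℕ) {q p : ℕ} (hpq : p ≤ q) :
    ∃ H : Finset (Finset (Fin n)), IsRGraph r H ∧ HasProperty r q p H ∧
      H.card = minEdges r n q p :=
  Nat.sInf_mem (s := {m : ℕ | ∃ H : Finset (Finset (Fin n)), IsRGraph r H ∧
    HasProperty r q p H ∧ H.card = m})
    ⟨_, powersetCard r univ, fun _ he => (mem_powersetCard.1 he).2, hasProperty_complete hpq, rfl⟩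

lemma minEdges_le_choose (r n : ℕ) {q p : ℕ} (hpq : p ≤ q) : minEdges r n q p ≤ n.choose r := by
  have := minEdges_le_card (V := Fin n) (r := r) (H := powersetCard r univ)
    (fun _ he => (mem_powersetCard.1 he).2) (hasProperty_complete hpq)
  simpa using this

/-! ### Bad sets and averaging over M-sets -/

/-- The `q`-sets of vertices which contain no `p`-clique of `H`. -/
noncomputable def badSets {V : Type*} [Fintype V] (r q p : ℕ) (H : Finset (Finset V)) :
    Finset (Finset V) := by
  classical
  exact (powersetCard q univ).filter
    (fun A => ¬ ∃ B ⊆ A, B.card = p ∧ powersetCard r B ⊆ H)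

lemma mem_badSets {V : Type*} [Fintype V] {r q p : ℕ} {H : Finset (Finset V)} {A : Finset V} :
    A ∈ badSets r q p H ↔ A.card = q ∧ ¬ ∃ B ⊆ A, B.card = p ∧ powersetCard r B ⊆ H := by
  simp [badSets]

/-- The number of `M`-sets containing a given set `e`. -/
lemma card_powersetCard_filter_superset {V : Type*} [Fintype V] [DecidableEq V] (e : Finset V)
    {M : ℕ} (hM : e.card ≤ M) :
    ((powersetCard M (univ : Finset V)).filter (e ⊆ ·)).card
      = (Fintype.card V - e.card).choose (M - e.card) := by
  rw [← card_compl, ← card_powersetCard]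
  symm
  apply Finset.card_bij' (fun S _ => S ∪ e) (fun S _ => S \ e)
  · intro S hS
    obtain ⟨h1, h2⟩ := mem_powersetCard.1 hS
    have hd : Disjoint S e := by
      rw [← subset_compl_iff_disjoint_right]
      exact h1
    simp only [mem_filter, mem_powersetCard, subset_univ, true_and]
    refine ⟨?_, subset_union_right⟩
    rw [card_union_of_disjoint hd, h2]; omega
  · intro S hS
    simp only [mem_filter, mem_powersetCard, subset_univ, true_and] at hS
    rw [mem_powersetCard]
    refine ⟨?_, by rw [card_sdiff_of_subset hS.2, hS.1]⟩
    intro x hx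
    simpa using (mem_sdiff.1 hx).2
  · intro S hS
    obtain ⟨h1, h2⟩ := mem_powersetCard.1 hS
    have hd : Disjoint S e := by
      rw [← subset_compl_iff_disjoint_right]
      exact h1
    rw [union_sdiff_right, sdiff_eq_self_of_disjoint hd]
  · intro S hS
    simp only [mem_filter, mem_powersetCard, subset_univ, true_and] at hS
    exact sdiff_union_of_subset hS.2

lemma sum_card_filter_subset {V : Type*} [Fintype V] [DecidableEq V] {r M : ℕ} (hrM : r ≤ M)
    {H : Finset (Finset V)} (hH : IsRGraph r H) :
    ∑ S ∈ powersetCard M (univ : Finset V), (H.filter (· ⊆ S)).card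
      = H.card * (Fintype.card V - r).choose (M - r) := by
  simp only [card_filter]
  rw [sum_comm]
  simp only [← card_filter]
  rw [← smul_eq_mul, ← sum_const]
  apply sum_congr rfl
  intro e he
  rw [card_powersetCard_filter_superset e (by rw [hH e he]; exact hrM), hH e he]

/-- Averaging the number of edges over all `M`-sets of vertices. -/
lemma minEdges_mul_choose_le {V : Type*} [Fintype V] {r q p M : ℕ} (hrM : r ≤ M) (hqM : q ≤ M)
    {H : Finset (Finset V)} (hH : IsRGraph r H) :
    minEdges r M q p * (Fintype.card V).choose M ≤
      H.card * (Fintype.card V - r).choose (M - r) +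
      minEdges r M q p * ((badSets r q p H).card * (Fintype.card V - q).choose (M - q)) := by
  classical
  have hB : IsRGraph q (badSets r q p H) := fun e he => (mem_badSets.1 he).1
  rw [← sum_card_filter_subset hrM hH, ← sum_card_filter_subset hqM hB, mul_sum,
    ← sum_add_distrib, mul_comm, ← card_univ, ← card_powersetCard, ← smul_eq_mul, ← sum_const]
  apply sum_le_sum
  intro S hS
  have hSM := (mem_powersetCard.1 hS).2
  -- An M-set containing a bad set may span few edges; the second summand then already pays the full
  -- `minEdges r M q p`.
  by_cases h : ((badSets r q p H).filter (· ⊆ S)).card = 0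
  · rw [h, ← hSM]
    refine (minEdges_le_card_filter hH S fun A hAS hA => ?_).trans (Nat.le_add_right _ _)
    by_contra hbad
    have : A ∈ (badSets r q p H).filter (· ⊆ S) :=
      mem_filter.2 ⟨mem_badSets.2 ⟨hA, hbad⟩, hAS⟩
    rw [card_eq_zero.1 h] at this
    simp at this
  · exact (Nat.le_mul_of_pos_right _ (Nat.pos_of_ne_zero h)).trans (Nat.le_add_left _ _)

lemma choose_sub_div_choose {n M r : ℕ} (hMn : M ≤ n) (hrM : r ≤ M) :
    ((n - r).choose (M - r) : ℝ) / n.choose M = M.choose r / n.choose r := by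
  have h1 : (0 : ℝ) < n.choose M := by exact_mod_cast Nat.choose_pos hMn
  have h2 : (0 : ℝ) < n.choose r := by exact_mod_cast Nat.choose_pos (hrM.trans hMn)
  rw [div_eq_div_iff h1.ne' h2.ne']
  have := Nat.choose_mul (n := n) (k := M) (s := r) hrM
  have h3 : (n.choose M : ℝ) * M.choose r = n.choose r * (n - r).choose (M - r) := by
    exact_mod_cast this
  linarith

/-- Normalised averaging: the loss factor is a union bound on the chance that a random M-set
contains a bad q-set. With no bad sets it gives monotonicity in n. -/
lemma minEdges_div_choose_le {V : Type*} [Fintype V] {r q p M : ℕ} (hrM : r ≤ M) (hqM : q ≤ M)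
    (hM : M ≤ Fintype.card V) {H : Finset (Finset V)} (hH : IsRGraph r H) :
    (minEdges r M q p : ℝ) / M.choose r *
      (1 - (badSets r q p H).card / (Fintype.card V).choose q * M.choose q) ≤
      H.card / (Fintype.card V).choose r := by
  set n := Fintype.card V
  have h1 : (0 : ℝ) < n.choose M := by exact_mod_cast Nat.choose_pos hM
  have h2 : (0 : ℝ) < M.choose r := by exact_mod_cast Nat.choose_pos hrM
  have key : (minEdges r M q p : ℝ) * n.choose M ≤ H.card * (n - r).choose (M - r) +
      minEdges r M q p * ((badSets r q p H).card * (n - q).choose (M - q)) := by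
    exact_mod_cast minEdges_mul_choose_le (p := p) hrM hqM hH
  have e1 := choose_sub_div_choose hM hrM
  have e2 := choose_sub_div_choose hM hqM
  rw [div_eq_iff h1.ne'] at e1 e2
  rw [e1, e2] at key
  have key2 : (minEdges r M q p : ℝ) ≤ H.card * (M.choose r / n.choose r) +
      minEdges r M q p * ((badSets r q p H).card * (M.choose q / n.choose q)) := by
    refine le_of_mul_le_mul_right ?_ h1
    linarith
  rw [div_mul_eq_mul_div, div_le_iff₀ h2]
  have e3 : (H.card : ℝ) / n.choose r * M.choose r = H.card * (M.choose r / n.choose r) := by ring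
  have e4 : ((badSets r q p H).card : ℝ) / n.choose q * M.choose q
    = (badSets r q p H).card * (M.choose q / n.choose q) := by ring
  rw [e3, e4]
  linarith

lemma HasProperty.badSets_eq_empty {V : Type*} [Fintype V] {r q p : ℕ} {H : Finset (Finset V)}
    (h : HasProperty r q p H) : badSets r q p H = ∅ := by
  rw [eq_empty_iff_forall_notMem]
  intro A hA
  exact (mem_badSets.1 hA).2 (h A (mem_badSets.1 hA).1)

lemma minEdges_div_choose_mono {r q p M n : ℕ} (hpq : p ≤ q) (hrM : r ≤ M) (hqM : q ≤ M)
    (hMn : M ≤ n) :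
    (minEdges r M q p : ℝ) / M.choose r ≤ minEdges r n q p / n.choose r := by
  obtain ⟨H, hH, hP, hc⟩ := exists_card_eq_minEdges r n hpq
  have := minEdges_div_choose_le (p := p) hrM hqM (by simpa using hMn) hH
  simpa [hP.badSets_eq_empty, hc] using this

lemma minEdges_div_choose_le_one {r q p : ℕ} (hpq : p ≤ q) (n : ℕ) :
    (minEdges r n q p : ℝ) / n.choose r ≤ 1 :=
  div_le_one_of_le₀ (by exact_mod_cast minEdges_le_choose r n hpq) (Nat.cast_nonneg _)

lemma tendsto_density (r : ℕ) {q p : ℕ} (hpq : p ≤ q) :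
    Tendsto (fun n : ℕ => (minEdges r n q p : ℝ) / n.choose r) atTop (𝓝 (density r q p)) := by
  apply tendsto_nhds_limUnder
  let g : ℕ → ℝ := fun n => (minEdges r (n + (r + q)) q p : ℝ) / (n + (r + q)).choose r
  have hg : Monotone g := fun a b hab =>
    minEdges_div_choose_mono hpq (by omega) (by omega) (by omega)
  have hb : BddAbove (Set.range g) := ⟨1, by
    rintro _ ⟨n, rfl⟩
    exact minEdges_div_choose_le_one hpq _⟩
  exact ⟨_, (tendsto_add_atTop_iff_nat (f := fun n : ℕ => (minEdges r n q p : ℝ) / n.choose r)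
    (r + q)).1 (tendsto_atTop_ciSup hg hb)⟩

lemma density_le_one (r : ℕ) {q p : ℕ} (hpq : p ≤ q) : density r q p ≤ 1 :=
  le_of_tendsto' (tendsto_density r hpq) fun n => minEdges_div_choose_le_one hpq n

/-! ### Boxes in dense sets of tuples -/

lemma pow_le_factorial_mul_choose {x : ℝ} {a m : ℕ} (hx : 0 ≤ x) (h : x + m ≤ a) :
    x ^ m ≤ m.factorial * a.choose m := by
  have hma : m ≤ a := by
    have : (m : ℝ) ≤ a := by linarith
    exact_mod_cast this
  have h1 : ((a + 1 - m : ℕ) : ℝ) ^ m ≤ a.descFactorial m := by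
    exact_mod_cast Nat.pow_sub_le_descFactorial a m
  rw [Nat.descFactorial_eq_factorial_mul_choose] at h1
  push_cast at h1
  refine (pow_le_pow_left₀ hx ?_ m).trans h1
  rw [Nat.cast_sub (by omega)]
  push_cast
  linarith

lemma factorial_mul_choose_le_pow (n m : ℕ) : (m.factorial * n.choose m : ℝ) ≤ (n : ℝ) ^ m := by
  have := Nat.descFactorial_le_pow n m
  rw [Nat.descFactorial_eq_factorial_mul_choose] at this
  exact_mod_cast this

/-- If a relation between `X` and `V` has density at least `ε`, some `m`-subset of `V` has a common
neighbourhood of positive density in `X`. -/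
lemma exists_card_commonNeighbors_ge {X V : Type*} [Fintype X] [Fintype V] [Nonempty X] [Nonempty V]
    (R : X → Finset V) {ε : ℝ} (hε : 0 < ε) (m : ℕ)
    (hV : 4 * m / ε ≤ Fintype.card V) (hV' : m ≤ Fintype.card V)
    (hR : ε * (Fintype.card X * Fintype.card V) ≤ ∑ x, ((R x).card : ℝ)) :
    ∃ Y : Finset V, Y.card = m ∧
      ε / 2 * (ε / 4) ^ m * Fintype.card X ≤ (Nat.card {x // Y ⊆ R x} : ℝ) := by
  classical
  set n := Fintype.card V
  set N := Fintype.card X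
  by_contra! hcon
  have hN : (0 : ℝ) < N := by exact_mod_cast Fintype.card_pos
  rw [div_le_iff₀ hε] at hV
  have hn : (0 : ℝ) < n := by exact_mod_cast Fintype.card_pos
  let Gd : Finset X := univ.filter (fun x => ε / 2 * n ≤ (R x).card)
  -- many elements of `X` have large degree
  have hGd : ε / 2 * N * n ≤ Gd.card * n := by
    have h1 : ∑ x, ((R x).card : ℝ) ≤ ∑ x, ((if x ∈ Gd then (n : ℝ) else 0) + ε / 2 * n) := by
      apply sum_le_sum
      intro x _
      by_cases hx : x ∈ Gd
      · rw [if_pos hx]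
        have : ((R x).card : ℝ) ≤ n := by exact_mod_cast card_le_univ _
        have : 0 ≤ ε / 2 * n := by positivity
        linarith
      · rw [if_neg hx]
        simp only [Gd, mem_filter, mem_univ, true_and, not_le] at hx
        linarith
    rw [sum_add_distrib, ← sum_filter] at h1
    simp only [sum_const, nsmul_eq_mul, filter_mem_eq_inter, univ_inter, card_univ] at h1
    change _ ≤ _ + (N : ℝ) * _ at h1
    nlinarith
  have hsum : ∑ Y ∈ powersetCard m (univ : Finset V), (Nat.card {x // Y ⊆ R x} : ℝ)
      = ∑ x, ((R x).card.choose m : ℝ) := by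
    have : ∀ Y : Finset V, (Nat.card {x // Y ⊆ R x} : ℝ) = ∑ x, if Y ⊆ R x then (1 : ℝ) else 0 := by
      intro Y
      rw [Nat.card_eq_fintype_card, Fintype.card_subtype, card_filter]
      push_cast
      rfl
    simp only [this]
    rw [sum_comm]
    apply sum_congr rfl
    intro x _
    rw [← card_powersetCard, ← sum_filter, sum_const, nsmul_eq_mul, mul_one]
    congr 2
    ext Y
    simp [mem_powersetCard, and_comm]
  have hlow : (Gd.card : ℝ) * (ε / 4 * n) ^ m ≤ m.factorial * ∑ x, ((R x).card.choose m : ℝ) := by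
    rw [mul_sum, ← nsmul_eq_mul, ← sum_const]
    refine (sum_le_sum fun x hx => ?_).trans
      (sum_le_sum_of_subset_of_nonneg (subset_univ Gd) fun x _ _ => by positivity)
    -- `hV` says m ≤ εn/4, so a degree of at least εn/2 exceeds m by at least εn/4.
    apply pow_le_factorial_mul_choose (by positivity)
    have : ε / 2 * n ≤ (R x).card := by simpa [Gd] using hx
    linarith
  have hup : ∑ Y ∈ powersetCard m (univ : Finset V), (Nat.card {x // Y ⊆ R x} : ℝ)
      < n.choose m * (ε / 2 * (ε / 4) ^ m * N) := by
    have : (powersetCard m (univ : Finset V)).Nonempty := powersetCard_nonempty.2 hV'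
    refine (sum_lt_sum_of_nonempty this fun Y hY => hcon Y (mem_powersetCard.1 hY).2).trans_eq ?_
    rw [sum_const, card_powersetCard, card_univ, nsmul_eq_mul]
  rw [hsum] at hup
  have hfac : (0 : ℝ) < m.factorial := by exact_mod_cast m.factorial_pos
  have h5 := factorial_mul_choose_le_pow n m
  have h6 : (Gd.card : ℝ) * (ε / 4 * n) ^ m < ε / 2 * N * (ε / 4 * n) ^ m := by
    calc _ ≤ _ := hlow
      _ < m.factorial * (n.choose m * (ε / 2 * (ε / 4) ^ m * N)) := by gcongr
      _ = (m.factorial * n.choose m) * (ε / 2 * (ε / 4) ^ m * N) := by ring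
      _ ≤ (n : ℝ) ^ m * (ε / 2 * (ε / 4) ^ m * N) := by gcongr
      _ = _ := by rw [mul_pow]; ring
  have h7 := lt_of_mul_lt_mul_right h6 (by positivity)
  exact absurd (le_of_mul_le_mul_right hGd hn) (not_le.2 h7)

/-- A set of `q`-tuples of positive density in `V ^ q` contains a product of `q` sets of size `m`,
provided that `V` is large. -/
lemma exists_box_subset (q m : ℕ) : ∀ ε : ℝ, 0 < ε → ∃ n₀ : ℕ, ∀ (V : Type) [Fintype V],
    n₀ ≤ Fintype.card V → ∀ G : Set (Fin q → V),
    ε * (Fintype.card V : ℝ) ^ q ≤ (Nat.card G : ℝ) →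
    ∃ X : Fin q → Finset V, (∀ i, (X i).card = m) ∧ ∀ x : Fin q → V, (∀ i, x i ∈ X i) → x ∈ G := by
  classical
  induction q with
  | zero =>
    intro ε hε
    refine ⟨0, fun V _ _ G hG => ⟨Fin.elim0, fun i => i.elim0, fun x _ => ?_⟩⟩
    by_contra hx
    have : G = ∅ := by
      ext y
      simpa [Subsingleton.elim y x] using hx
    subst this
    simp at hG
    linarith
  | succ q ih =>
    intro ε hε
    obtain ⟨n₁, hn₁⟩ := ih (ε / 2 * (ε / 4) ^ m) (by positivity)
    refine ⟨max (max n₁ (m + 1)) ⌈4 * m / ε⌉₊, fun V _ hV G hG => ?_⟩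
    have hV1 : n₁ ≤ Fintype.card V := le_trans (by simp) hV
    have hV2 : m + 1 ≤ Fintype.card V := le_trans (by simp) hV
    have hV3 : 4 * m / ε ≤ Fintype.card V :=
      (Nat.le_ceil _).trans (by exact_mod_cast le_trans (le_max_right _ _) hV)
    have : Nonempty V := Fintype.card_pos_iff.1 (by omega)
    -- Split off the first coordinate: a common neighbourhood of an m-set `Y` is a dense set of
    -- q-tuples, to which induction applies.
    let R : (Fin q → V) → Finset V := fun x => univ.filter (fun y => Fin.cons y x ∈ G)
    have hcard : Nat.card G = ∑ x, (R x).card := by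
      rw [← card_sigma, Nat.card_eq_fintype_card, ← Set.toFinset_card]
      refine Finset.card_bij' (fun g _ => ⟨Fin.tail g, g 0⟩) (fun z _ => Fin.cons z.2 z.1) ?_ ?_ ?_ ?_
      · intro g hg
        simpa [R] using hg
      · intro z hz
        simpa [R] using hz
      · intro g _
        simp
      · intro z _
        simp
    obtain ⟨Y, hY, hYc⟩ := exists_card_commonNeighbors_ge R hε m hV3 (by omega) (by
      rw [Fintype.card_fun, Fintype.card_fin]
      rw [hcard] at hG
      push_cast at hG ⊢
      rwa [pow_succ] at hG)
    obtain ⟨X, hX, hXG⟩ := hn₁ V hV1 {x | Y ⊆ R x} (by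
      rw [Fintype.card_fun, Fintype.card_fin] at hYc
      push_cast at hYc
      exact hYc)
    refine ⟨Fin.cons Y X, fun i => ?_, fun x hx => ?_⟩
    · refine Fin.cases ?_ (fun i => ?_) i
      · simpa using hY
      · simpa using hX i
    · have h0 : x 0 ∈ Y := by simpa using hx 0
      have h1 : Y ⊆ R (Fin.tail x) := hXG _ fun i => by simpa [Fin.tail] using hx i.succ
      simpa [R] using h1 h0

/-! ### The blow-up inequality -/

/-- In an `r`-graph with the `(Q, P)`-property, the `q`-sets without a `p`-clique contain no complete
`q`-partite family with parts of size `m`. -/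
lemma HasProperty.not_box_badSets {V : Type*} [Fintype V] [DecidableEq V] {r q p Q P m : ℕ}
    {H : Finset (Finset V)} (hH : HasProperty r Q P H) (hQ : Q ≤ q * m)
    (hP : (p - 1) * m < P) (hPQ : P ≤ Q) (X : Fin q → Finset V) (hX : ∀ i, (X i).card = m)
    (hbad : ∀ x : Fin q → V, (∀ i, x i ∈ X i) → univ.image x ∈ badSets r q p H) : False := by
  have hm : 0 < m := by
    rcases Nat.eq_zero_or_pos m with h | h
    · subst h; simp at hQ; omega
    · exact h
  have hne : ∀ i, (X i).Nonempty := fun i => card_pos.1 (by rw [hX]; exact hm)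
  choose d hd using hne
  have hinj : ∀ x : Fin q → V, (∀ i, x i ∈ X i) → Function.Injective x := fun x hx => by
    have h := (mem_badSets.1 (hbad x hx)).1
    have h' : (univ.image x).card = (univ : Finset (Fin q)).card := by
      rw [h, card_univ, Fintype.card_fin]
    exact fun a b hab => card_image_iff.1 h' (mem_coe.2 (mem_univ a)) (mem_coe.2 (mem_univ b)) hab
  have hdisj : Set.PairwiseDisjoint (↑(univ : Finset (Fin q))) X := by
    intro i _ j _ hij
    rw [Function.onFun, Finset.disjoint_left]
    intro v hvi hvj
    -- A vertex shared by two parts would give a transversal that repeats it, whose image has fewer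
    -- than q elements.
    let x : Fin q → V := fun k => if k = i ∨ k = j then v else d k
    have hx : ∀ k, x k ∈ X k := fun k => by
      by_cases hk : k = i ∨ k = j
      · simp only [x, if_pos hk]
        rcases hk with rfl | rfl <;> assumption
      · simp only [x, if_neg hk]
        exact hd k
    exact hij (hinj x hx (by simp [x]))
  have hU : (univ.biUnion X).card = q * m := by
    rw [card_biUnion hdisj]
    simp [hX]
  obtain ⟨A, hAU, hA⟩ := Finset.exists_subset_card_eq (hU ▸ hQ)
  obtain ⟨B, hBA, hB, hBH⟩ := hH A hA
  let I : Finset (Fin q) := univ.filter (fun i => (X i ∩ B).Nonempty)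
  have hBI : B.card ≤ I.card * m := by
    have hsub : B ⊆ I.biUnion X := by
      intro v hv
      obtain ⟨i, -, hi⟩ := mem_biUnion.1 (hAU (hBA hv))
      exact mem_biUnion.2 ⟨i, by simpa [I] using ⟨v, mem_inter.2 ⟨hi, hv⟩⟩, hi⟩
    exact (card_le_card hsub).trans (card_biUnion_le_card_mul _ _ _ fun i _ => (hX i).le)
  have hI : p ≤ I.card := by
    have : (p - 1) * m < I.card * m := by omega
    have := Nat.lt_of_mul_lt_mul_right this
    omega
  obtain ⟨J, hJI, hJ⟩ := Finset.exists_subset_card_eq hI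
  -- The transversal passes through the clique `B` in every part that `B` meets.
  have hex : ∀ i, ∃ v ∈ X i, i ∈ I → v ∈ B := fun i => by
    by_cases hi : i ∈ I
    · obtain ⟨v, hv⟩ := (mem_filter.1 hi).2
      exact ⟨v, (mem_inter.1 hv).1, fun _ => (mem_inter.1 hv).2⟩
    · exact ⟨d i, hd i, fun h => absurd h hi⟩
  choose x hxX hxB using hex
  refine (mem_badSets.1 (hbad x hxX)).2 ⟨J.image x, image_subset_image (subset_univ _), ?_, ?_⟩
  · rw [card_image_of_injective _ (hinj x hxX), hJ]
  · refine (powersetCard_mono ?_).trans hBH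
    intro v hv
    obtain ⟨i, hi, rfl⟩ := mem_image.1 hv
    exact hxB i (hJI hi)

lemma card_badSets_le {r q p Q P m : ℕ} (hQ : Q ≤ q * m) (hP : (p - 1) * m < P)
    (hPQ : P ≤ Q) {ε : ℝ} (hε : 0 < ε) : ∃ n₀ : ℕ, ∀ (V : Type) [Fintype V],
    n₀ ≤ Fintype.card V → ∀ H : Finset (Finset V), HasProperty r Q P H →
    ((badSets r q p H).card : ℝ) ≤ ε * (Fintype.card V).choose q := by
  classical
  have hfac : (0 : ℝ) < q.factorial := by exact_mod_cast q.factorial_pos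
  -- For n ≥ 2q, (n/2)^q ≤ q!·C(n,q); this converts density among q-sets into density among
  -- q-tuples.
  obtain ⟨n₀, hn₀⟩ := exists_box_subset q m (ε / (2 ^ q * q.factorial)) (by positivity)
  refine ⟨max n₀ (2 * q), fun V _ hV H hH => ?_⟩
  by_contra! hlt
  have hV2 : 2 * q ≤ Fintype.card V := le_trans (by simp) hV
  obtain ⟨X, hX, hbad⟩ := hn₀ V (le_trans (by simp) hV)
    {x | univ.image x ∈ badSets r q p H} (by
      have h1 : ((Fintype.card V : ℝ) / 2) ^ q ≤ q.factorial * (Fintype.card V).choose q := by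
        apply pow_le_factorial_mul_choose (by positivity)
        have : (2 * q : ℝ) ≤ Fintype.card V := by exact_mod_cast hV2
        linarith
      have h2 : (badSets r q p H).card
          ≤ Nat.card {x : Fin q → V | univ.image x ∈ badSets r q p H} := by
        rw [Nat.card_eq_fintype_card, ← Set.toFinset_card]
        apply Finset.card_le_card_of_surjOn (fun x => univ.image x)
        intro A hA
        have hAq : A.card = q := (mem_badSets.1 (mem_coe.1 hA)).1
        have him : univ.image (fun i => ((A.equivFinOfCardEq hAq).symm i : V)) = A := by
          ext v
          simp only [mem_image, mem_univ, true_and]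
          constructor
          · rintro ⟨i, rfl⟩
            exact Subtype.prop _
          · intro hv
            exact ⟨A.equivFinOfCardEq hAq ⟨v, hv⟩, by simp⟩
        refine ⟨fun i => ((A.equivFinOfCardEq hAq).symm i : V), ?_, him⟩
        simpa [him] using hA
      have h3 : ((badSets r q p H).card : ℝ)
          ≤ Nat.card {x : Fin q → V | univ.image x ∈ badSets r q p H} := by exact_mod_cast h2
      calc ε / (2 ^ q * q.factorial) * (Fintype.card V : ℝ) ^ q
          = ε / q.factorial * ((Fintype.card V : ℝ) / 2) ^ q := by
            rw [div_pow]; field_simp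
        _ ≤ ε / q.factorial * (q.factorial * (Fintype.card V).choose q) := by gcongr
        _ = ε * (Fintype.card V).choose q := by field_simp
        _ ≤ _ := hlt.le.trans h3)
  exact hH.not_box_badSets hQ hP hPQ X hX fun x hx => hbad x hx

/-- The densities `t_r(q, p)` are monotone along blow-ups. -/
lemma density_le_density (r : ℕ) {q p Q P m : ℕ} (hpq : p ≤ q) (hQ : Q ≤ q * m)
    (hP : (p - 1) * m < P) (hPQ : P ≤ Q) : density r q p ≤ density r Q P := by
  refine le_of_tendsto (tendsto_density r hpq) ?_
  filter_upwards [eventually_ge_atTop (max r q)] with M hM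
  have hrM : r ≤ M := le_trans (le_max_left _ _) hM
  have hqM : q ≤ M := le_trans (le_max_right _ _) hM
  set a : ℝ := (minEdges r M q p : ℝ) / M.choose r
  have ha : 0 ≤ a := by positivity
  have hε : ∀ ε : ℝ, 0 < ε → a * (1 - ε * M.choose q) ≤ density r Q P := by
    intro ε hε
    obtain ⟨n₀, hn₀⟩ := card_badSets_le (r := r) hQ hP hPQ hε
    refine ge_of_tendsto (tendsto_density r hPQ) ?_
    filter_upwards [eventually_ge_atTop (max n₀ M)] with n hn
    have hMn : M ≤ n := le_trans (le_max_right _ _) hn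
    obtain ⟨H, hH, hHP, hc⟩ := exists_card_eq_minEdges r n hPQ
    have h1 := minEdges_div_choose_le (p := p) hrM hqM (by simpa using hMn) hH
    have h2 := hn₀ (Fin n) (by simpa using le_trans (le_max_left _ _) hn) H hHP
    rw [hc] at h1
    simp only [Fintype.card_fin] at h1 h2
    have h3 : (0 : ℝ) < n.choose q := by exact_mod_cast Nat.choose_pos (hqM.trans hMn)
    refine le_trans (mul_le_mul_of_nonneg_left ?_ ha) h1
    have := (div_le_iff₀ h3).2 h2
    gcongr
  -- M stays fixed while ε → 0, so the factor C(M,q) is harmless.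
  have hlim : Tendsto (fun ε : ℝ => a * (1 - ε * M.choose q)) (𝓝[>] 0) (𝓝 a) := by
    have : ContinuousAt (fun ε : ℝ => a * (1 - ε * M.choose q)) 0 := by fun_prop
    have := this.tendsto
    simp only [zero_mul, sub_zero, mul_one] at this
    exact this.mono_left nhdsWithin_le_nhds
  exact le_of_tendsto hlim (eventually_mem_nhdsWithin.mono fun ε h => hε ε h)

/-! ### Upper bound from disjoint cliques -/

lemma pow_mul_choose_le (t N r : ℕ) (ht : 1 ≤ t) : t ^ r * N.choose r ≤ (t * N).choose r := by
  have h : ∀ k, t ^ k * N.descFactorial k ≤ (t * N).descFactorial k := by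
    intro k
    induction k with
    | zero => simp
    | succ k ih =>
      rw [Nat.descFactorial_succ, Nat.descFactorial_succ]
      calc t ^ (k + 1) * ((N - k) * N.descFactorial k)
          = (t * N - t * k) * (t ^ k * N.descFactorial k) := by rw [← Nat.mul_sub]; ring
        _ ≤ (t * N - k) * (t * N).descFactorial k := by
          gcongr
          nlinarith
  have := h r
  rw [Nat.descFactorial_eq_factorial_mul_choose, Nat.descFactorial_eq_factorial_mul_choose,
    mul_left_comm] at this
  exact Nat.le_of_mul_le_mul_left this r.factorial_pos

/-- The disjoint union of `t` cliques of size `N`. -/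
lemma minEdges_mul_le (r t N : ℕ) {q p : ℕ} (h : t * (p - 1) < q) :
    minEdges r (t * N) q p ≤ t * N.choose r := by
  classical
  let part : Fin t → Finset (Fin t × Fin N) := fun c => univ.filter (fun v => v.1 = c)
  have hpart : ∀ c, (part c).card = N := fun c => by
    have : part c = {c} ×ˢ univ := by
      ext ⟨a, b⟩
      simp [part, eq_comm]
    rw [this, card_product]
    simp
  let H : Finset (Finset (Fin t × Fin N)) := univ.biUnion fun c => powersetCard r (part c)
  have hH : IsRGraph r H := fun e he => by
    obtain ⟨c, -, hc⟩ := mem_biUnion.1 he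
    exact (mem_powersetCard.1 hc).2
  have hP : HasProperty r q p H := fun A hA => by
    obtain ⟨c, -, hc⟩ := exists_lt_card_fiber_of_mul_lt_card_of_maps_to (s := A)
      (t := (univ : Finset (Fin t))) (f := Prod.fst) (n := p - 1) (fun _ _ => mem_univ _)
      (by simpa [hA] using h)
    obtain ⟨B, hB, hBp⟩ := Finset.exists_subset_card_eq (show p ≤ (A.filter (·.1 = c)).card by omega)
    refine ⟨B, hB.trans (filter_subset _ _), hBp, ?_⟩
    refine (powersetCard_mono (hB.trans ?_)).trans
      (subset_biUnion_of_mem (fun c => powersetCard r (part c)) (mem_univ c))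
    exact filter_subset_filter _ (subset_univ _)
  have := minEdges_le_card hH hP
  rw [Fintype.card_prod, Fintype.card_fin, Fintype.card_fin] at this
  refine this.trans (card_biUnion_le.trans ?_)
  simp [hpart]

/-- Since the density is a limit, it may be computed along n = tN, where t cliques of size N have
t·C(N,r) ≤ t^(1-r)·C(tN,r) edges. -/
lemma density_le_of_mul_lt {r t q p : ℕ} (hr : 1 ≤ r) (ht : 1 ≤ t) (hpq : p ≤ q)
    (h : t * (p - 1) < q) : density r q p ≤ 1 / (t : ℝ) ^ (r - 1) := by
  have hlim : Tendsto (fun N : ℕ => t * N) atTop atTop :=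
    tendsto_id.const_mul_atTop' ht
  refine le_of_tendsto ((tendsto_density r hpq).comp hlim) ?_
  filter_upwards [eventually_ge_atTop r] with N hN
  have ht' : (0 : ℝ) < t := by exact_mod_cast ht
  have hc : (0 : ℝ) < (t * N).choose r := by
    exact_mod_cast Nat.choose_pos (hN.trans (Nat.le_mul_of_pos_left _ ht))
  have h1 : (minEdges r (t * N) q p : ℝ) ≤ t * N.choose r := by
    exact_mod_cast minEdges_mul_le r t N h
  have h2 : (t : ℝ) ^ r * N.choose r ≤ (t * N).choose r := by
    exact_mod_cast pow_mul_choose_le t N r ht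
  simp only [Function.comp_apply]
  rw [div_le_div_iff₀ hc (by positivity), one_mul]
  calc (minEdges r (t * N) q p : ℝ) * t ^ (r - 1) ≤ t * N.choose r * t ^ (r - 1) := by gcongr
    _ = t ^ (r - 1 + 1) * N.choose r := by ring
    _ = t ^ r * N.choose r := by rw [Nat.sub_add_cancel hr]
    _ ≤ _ := h2

/-! ### The limit in q -/

lemma ceil_div_le {γ : ℝ} (hγ : 1 ≤ γ) (q : ℕ) : ⌈(q : ℝ) / γ⌉₊ ≤ q :=
  Nat.ceil_le.2 (div_le_self (Nat.cast_nonneg _) hγ)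

lemma ceil_div_sub_one_mul_lt {γ : ℝ} (hγ : 1 ≤ γ) {q : ℕ} (hq : 1 ≤ q) :
    ((⌈(q : ℝ) / γ⌉₊ - 1 : ℕ) : ℝ) * γ < q := by
  have hγ0 : 0 < γ := by linarith
  have hq0 : (0 : ℝ) < q := by exact_mod_cast hq
  have h1 : 1 ≤ ⌈(q : ℝ) / γ⌉₊ := Nat.ceil_pos.2 (by positivity)
  rw [Nat.cast_sub h1, ← lt_div_iff₀ hγ0]
  have := Nat.ceil_lt_add_one (a := (q : ℝ) / γ) (by positivity)
  push_cast
  linarith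

lemma eventually_density_le (r : ℕ) {γ : ℝ} (hγ : 1 ≤ γ) {q p : ℕ} (hpq : p ≤ q)
    (h : ((p - 1 : ℕ) : ℝ) * γ < q) :
    ∀ᶠ Q : ℕ in atTop, density r q p ≤ density r Q ⌈(Q : ℝ) / γ⌉₊ := by
  have hγ0 : 0 < γ := by linarith
  have hq0 : (0 : ℝ) < q := lt_of_le_of_lt (by positivity) h
  have hq1 : 0 < q := by exact_mod_cast hq0
  -- With m = ⌊Q/q⌋ + 1, it suffices that (p-1)(Q+q)γ < Qq; solving for Q gives this threshold.
  obtain ⟨Q₀, hQ₀⟩ := exists_nat_gt (((p - 1 : ℕ) : ℝ) * γ * q / (q - (p - 1 : ℕ) * γ))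
  filter_upwards [eventually_ge_atTop Q₀] with Q hQ
  have hQ' : ((p - 1 : ℕ) : ℝ) * γ * q < Q * (q - (p - 1 : ℕ) * γ) := by
    rw [← div_lt_iff₀ (by linarith)]
    exact hQ₀.trans_le (by exact_mod_cast hQ)
  refine density_le_density r (m := Q / q + 1) hpq (Nat.lt_mul_div_succ Q hq1).le ?_
    (ceil_div_le hγ Q)
  rw [Nat.lt_ceil, lt_div_iff₀ hγ0]
  push_cast
  have h1 : ((Q / q : ℕ) : ℝ) ≤ Q / q := Nat.cast_div_le
  calc ((p - 1 : ℕ) : ℝ) * (((Q / q : ℕ) : ℝ) + 1) * γ ≤ (p - 1 : ℕ) * (Q / q + 1) * γ := by gcongr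
    _ < Q := by
      rw [← mul_lt_mul_iff_left₀ hq0]
      have : ((p - 1 : ℕ) : ℝ) * (Q / q + 1) * γ * q = (p - 1 : ℕ) * (Q + q) * γ := by
        field_simp
      rw [this]
      linarith

lemma tendsto_asympDensity (r : ℕ) {γ : ℝ} (hγ : 1 ≤ γ) :
    Tendsto (fun q : ℕ => density r q ⌈(q : ℝ) / γ⌉₊) atTop (𝓝 (asympDensity r γ)) := by
  apply tendsto_nhds_limUnder
  set f : ℕ → ℝ := fun q => density r q ⌈(q : ℝ) / γ⌉₊
  -- The index is shifted because the strict inequality (p-1)γ < q fails at q = 0.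
  have hb : BddAbove (Set.range fun q => f (q + 1)) := ⟨1, by
    rintro _ ⟨q, rfl⟩
    exact density_le_one r (ceil_div_le hγ _)⟩
  refine ⟨⨆ q, f (q + 1), tendsto_order.2 ⟨fun a ha => ?_, fun a ha => ?_⟩⟩
  · obtain ⟨q, hq⟩ := exists_lt_of_lt_ciSup ha
    exact (eventually_density_le r hγ (ceil_div_le hγ (q + 1))
      (ceil_div_sub_one_mul_lt hγ (by omega))).mono fun Q hQ => hq.trans_le hQ
  · filter_upwards [eventually_ge_atTop 1] with q hq
    obtain ⟨k, rfl⟩ := Nat.exists_eq_add_of_le' hq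
    exact (le_ciSup hb k).trans_lt ha

end LocalTuran

theorem corollary2 (hTuran : LocalTuran.TuranConjecture) :
    (∀ k : ℕ, 2 ≤ k → ∀ γ : ℝ, 1 ≤ γ → γ < ((k : ℝ) + 1) / 2 →
      Filter.Tendsto (fun q : ℕ => LocalTuran.density 3 q ⌈(q : ℝ) / γ⌉₊) Filter.atTop
          (nhds (LocalTuran.asympDensity 3 γ)) ∧
        4 / (k : ℝ) ^ 2 ≤ LocalTuran.asympDensity 3 γ) ∧
    (∀ t : ℕ, 1 ≤ t → ∀ γ : ℝ, (t : ℝ) ≤ γ → γ < (t : ℝ) + 1 / 2 →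
      LocalTuran.asympDensity 3 γ = 1 / (t : ℝ) ^ 2) := by
  have lower : ∀ k : ℕ, 2 ≤ k → ∀ γ : ℝ, 1 ≤ γ → γ < ((k : ℝ) + 1) / 2 →
      4 / (k : ℝ) ^ 2 ≤ LocalTuran.asympDensity 3 γ := fun k hk γ hγ hγk => by
    rw [← hTuran k hk]
    refine ge_of_tendsto (LocalTuran.tendsto_asympDensity 3 hγ)
      (LocalTuran.eventually_density_le 3 hγ (by omega) ?_)
    push_cast
    linarith
  refine ⟨fun k hk γ hγ hγk => ⟨LocalTuran.tendsto_asympDensity 3 hγ, lower k hk γ hγ hγk⟩,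
    fun t ht γ htγ hγt => ?_⟩
  have ht1 : (1 : ℝ) ≤ t := by exact_mod_cast ht
  have hγ : 1 ≤ γ := ht1.trans htγ
  apply le_antisymm
  · refine le_of_tendsto (LocalTuran.tendsto_asympDensity 3 hγ) ?_
    filter_upwards [Filter.eventually_ge_atTop 1] with q hq
    refine LocalTuran.density_le_of_mul_lt (r := 3) (by omega) ht (LocalTuran.ceil_div_le hγ q) ?_
    have h1 := LocalTuran.ceil_div_sub_one_mul_lt hγ hq
    have h2 : (t : ℝ) * (⌈(q : ℝ) / γ⌉₊ - 1 : ℕ) < q := by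
      refine lt_of_le_of_lt ?_ h1
      rw [mul_comm]
      gcongr
    exact_mod_cast h2
  -- For k = 2t, (k+1)/2 = t + 1/2 and 4/k² = 1/t².
  · have h := lower (2 * t) (by omega) γ hγ (by push_cast; linarith)
    refine le_trans (le_of_eq ?_) h
    push_cast
    field_simp
    norm_num
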